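/- Let $K$ be a field, let $c\ge 1$ and $n,d,t\ge 0$ be integers, and let $S=K[x_1,\dots,x_n]$. A multiset $A=\{i_1\le i_2\le\dots\le i_d\}$ of $d$ elements of $\{1,\dots,n\}$ is called $t$-spread if $i_{k+1}-i_k\ge t$ for all $k$. A block of size $r$ of such an $A$ is a run $i_k\le i_{k+1}\le\dots\le i_{k+r-1}$ of consecutive elements of $A$ with $i_{l+1}-i_l=t$ for $k\le l<k+r-1$. The $c$-bounded $t$-spread Veronese ideal $I_{c,(n,d,t)}\subset S$ is the ideal generated by all monomials $x_{i_1}x_{i_2}\cdots x_{i_d}$ for which $A=\{i_1\le\dots\le i_d\}$ is $t$-spread and every block of $A$ has size at most $c$. Put $I=I_{c,(n,d,t)}$. Then: 1. If $I\neq 0$, then $I$ has the strong persistence property: $I^{k+1}:I=I^k$ for all $k\ge 0$. 2. Every power of $I$ has a linear resolution. More precisely, for every $k\ge 0$ the ideal $I^k$ has a $kd$-linear resolution, that is, a graded free resolution of the form $\cdots\to S(-kd-2)^{b_2}\to S(-kd-1)^{b_1}\to S(-kd)^{b_0}\to I^k\to 0$, where the integers $b_i\ge 0$ may be zero. -/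

import Mathlib

/-- A multiset `A = {i₁ ≤ i₂ ≤ ⋯ ≤ i_d}` on `n` indices is `t`-spread if `i_{k+1} - i_k ≥ t` for all
`k`. -/
def IsTSpread {n : ℕ} (t : ℕ) (A : Multiset (Fin n)) : Prop :=
  List.IsChain (fun i j : Fin n => (i : ℕ) + t ≤ (j : ℕ)) (A.sort (· ≤ ·))

/-- A block of the multiset `A = {i₁ ≤ ⋯ ≤ i_d}` is a run `i_k, i_{k+1}, …, i_{k+r-1}` of consecutive
entries of the sorted list of `A` in which each difference of neighbours equals `t`; its size is the
length `r` of the run. -/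
def IsTBlock {n : ℕ} (t : ℕ) (A : Multiset (Fin n)) (B : List (Fin n)) : Prop :=
  B <:+: A.sort (· ≤ ·) ∧ List.IsChain (fun i j : Fin n => (i : ℕ) + t = (j : ℕ)) B

/-- The set of all `t`-spread multisets of cardinality `d` on `n` indices all of whose blocks have
size at most `c`. -/
def boundedSpreadMultisets (c n d t : ℕ) : Set (Multiset (Fin n)) :=
  {A | A.card = d ∧ IsTSpread t A ∧ ∀ B : List (Fin n), IsTBlock t A B → B.length ≤ c}

/-- The monomial `x_A = x_{i₁} x_{i₂} ⋯ x_{i_d}` of a multiset `A = {i₁ ≤ ⋯ ≤ i_d}`. -/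
noncomputable def multisetMonomial (K : Type*) [Field K] {n : ℕ} (A : Multiset (Fin n)) :
    MvPolynomial (Fin n) K :=
  (A.map MvPolynomial.X).prod

/-- The `c`-bounded `t`-spread Veronese ideal of degree `d` in `K[x₁, …, xₙ]`. -/
noncomputable def boundedSpreadVeroneseIdeal (K : Type*) [Field K] (c n d t : ℕ) :
    Ideal (MvPolynomial (Fin n) K) :=
  Ideal.span (multisetMonomial K '' boundedSpreadMultisets c n d t)

/-- The strong persistence property: `I ^ (k + 1) : I = I ^ k` for all `k`. -/
def HasStrongPersistenceProperty {R : Type*} [CommRing R] (I : Ideal R) : Prop :=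
  ∀ k : ℕ, (I ^ (k + 1)).colon (I : Set R) = I ^ k

/-- The ideal `I` of `S = K[x₁, …, xₙ]` has a `q`-linear resolution: there is a graded free resolution
`⋯ → S(-q-2)^{b₂} → S(-q-1)^{b₁} → S(-q)^{b₀} → I → 0`.
In coordinates: a homogeneous map `S(-q)^{b₀} → I` is given by `b₀` forms `g j ∈ I` of degree `q`, and
a homogeneous map `S(-q-i-1)^{b_{i+1}} → S(-q-i)^{b_i}` by a matrix `M i` whose entries are linear
forms (possibly zero). As these entries lie in the maximal ideal `(x₁, …, xₙ)`, such a resolution is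
the minimal graded free resolution of `I`; the ranks `b i` may be zero. -/
def HasLinearResolution {K : Type*} [Field K] {n : ℕ} (q : ℕ)
    (I : Ideal (MvPolynomial (Fin n) K)) : Prop :=
  ∃ (b : ℕ → ℕ) (g : Fin (b 0) → MvPolynomial (Fin n) K)
    (M : ∀ i : ℕ, Matrix (Fin (b i)) (Fin (b (i + 1))) (MvPolynomial (Fin n) K)),
    (∀ j, (g j).IsHomogeneous q) ∧
    (∀ i r s, (M i r s).IsHomogeneous 1) ∧
    LinearMap.range (Fintype.linearCombination (MvPolynomial (Fin n) K) g) = I ∧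
    LinearMap.range (M 0).mulVecLin =
      LinearMap.ker (Fintype.linearCombination (MvPolynomial (Fin n) K) g) ∧
    ∀ i, LinearMap.range (M (i + 1)).mulVecLin = LinearMap.ker (M i).mulVecLin

/-! A multiset is encoded by its exponent vector `u` and the partial sums `U` of `u`. Being
`t`-spread with blocks of size at most `c` means having at most one element in each window `[a, a +
t)` and at most `c` in each window `[a, a + c * t + 1)`. These are difference constraints `U b - U a
≤ r`, and everything except this translation works for an arbitrary family of such constraints.

Rounding `U / (k + 1)` down splits a `(k + 1)`-bounded vector into a `1`-bounded and a `k`-bounded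
one (`IsIntervalBounded.exists_add`). Hence `I ^ k` is generated by the `k`-bounded exponents of
degree `k * d`.

Persistence rests on a max-min duality (`exists_isIntervalBounded_le`): the largest degree of a
`k`-bounded vector below `w` is the least cost of a cover of `[0, N)` by points, priced by `w`, and
intervals, priced by `k` times their capacity. Testing the colon condition on a generator of least
weight on the points of an optimal cover bounds that cost below by `k * d`.

For linearity, an exchange argument (`IsIntervalBounded.exists_exchange`) gives the generators of `I
^ k` linear quotients in decreasing lexicographic order. Linear quotients pass to syzygy modules
(`HasLinearQuotients.exists_syzygies`), so iteration builds the resolution. -/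

/-! ### Difference constraints on partial sums: decomposition and exchange. -/

section IntervalConstraints

/-- The sum of the first `m` values of `u`. -/
def partialSum (u : ℕ → ℕ) (m : ℕ) : ℕ := ∑ i ∈ Finset.range m, u i

theorem partialSum_succ (u : ℕ → ℕ) (m : ℕ) : partialSum u (m + 1) = partialSum u m + u m :=
  Finset.sum_range_succ u m

theorem partialSum_add (u v : ℕ → ℕ) (m : ℕ) :
    partialSum (u + v) m = partialSum u m + partialSum v m :=
  Finset.sum_add_distrib

theorem partialSum_mono (u : ℕ → ℕ) : Monotone (partialSum u) :=
  monotone_nat_of_le_succ fun m => by rw [partialSum_succ]; omega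

theorem partialSum_congr {u v : ℕ → ℕ} {m : ℕ} (h : ∀ i < m, u i = v i) :
    partialSum u m = partialSum v m :=
  Finset.sum_congr rfl fun i hi => h i (Finset.mem_range.mp hi)

/-- Vectors are constructed below by prescribing their partial sums, in which every constraint is a
bound on a difference. -/
theorem exists_partialSum_eq {U : ℕ → ℕ} (h0 : U 0 = 0) (hU : Monotone U) :
    ∃ u : ℕ → ℕ, ∀ m, partialSum u m = U m :=
  ⟨fun i => U (i + 1) - U i, fun m => by
    rw [partialSum, Finset.sum_range_tsub hU, h0, Nat.sub_zero]⟩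

/-- For a family `𝒥` of triples `(a, b, r)`, each standing for the interval `[a, b)` with capacity
`r`, the vector `u` has weight at most `k * r` on each of these intervals. -/
def IsIntervalBounded (𝒥 : Set (ℕ × ℕ × ℕ)) (k : ℕ) (u : ℕ → ℕ) : Prop :=
  ∀ a b r, (a, b, r) ∈ 𝒥 → partialSum u b ≤ partialSum u a + k * r

variable {𝒥 : Set (ℕ × ℕ × ℕ)}

theorem IsIntervalBounded.add {k l : ℕ} {u v : ℕ → ℕ} (hu : IsIntervalBounded 𝒥 k u)
    (hv : IsIntervalBounded 𝒥 l v) : IsIntervalBounded 𝒥 (k + l) (u + v) := by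
  intro a b r h
  have h1 := hu a b r h
  have h2 := hv a b r h
  rw [partialSum_add, partialSum_add, add_mul]
  omega

theorem sub_div_mono (k : ℕ) {x y : ℕ} (h : x ≤ y) : x - x / (k + 1) ≤ y - y / (k + 1) := by
  obtain ⟨s, rfl⟩ := Nat.exists_eq_add_of_le h
  have h1 : (x + s) / (k + 1) ≤ x / (k + 1) + s := by
    rw [← Nat.add_mul_div_left x s (Nat.succ_pos k)]
    exact Nat.div_le_div_right (by nlinarith)
  have h2 := Nat.div_le_self x (k + 1)
  omega

/-- Integer decomposition: a `(k + 1)`-bounded vector is the sum of a `1`-bounded vector and a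
`k`-bounded one. -/
theorem IsIntervalBounded.exists_add {k : ℕ} {u : ℕ → ℕ} (hu : IsIntervalBounded 𝒥 (k + 1) u) :
    ∃ v v' : ℕ → ℕ, u = v + v' ∧ IsIntervalBounded 𝒥 1 v ∧ IsIntervalBounded 𝒥 k v' ∧
      ∀ m d, partialSum u m = (k + 1) * d → partialSum v m = d := by
  -- Division by `k + 1` is monotone and turns a shift by `(k + 1) * r` into a shift by `r`, leaving
  -- `k * r` for the remainder. So each constraint passes to both summands.
  obtain ⟨v, hv⟩ := exists_partialSum_eq (U := fun m => partialSum u m / (k + 1))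
    (by simp [partialSum]) fun _ _ h => Nat.div_le_div_right (partialSum_mono u h)
  obtain ⟨v', hv'⟩ := exists_partialSum_eq
    (U := fun m => partialSum u m - partialSum u m / (k + 1))
    (by simp [partialSum]) fun _ _ h => sub_div_mono k (partialSum_mono u h)
  have hsum : ∀ m, partialSum u m = partialSum v m + partialSum v' m := fun m => by
    have := Nat.div_le_self (partialSum u m) (k + 1)
    rw [hv, hv']
    omega
  refine ⟨v, v', ?_, ?_, ?_, ?_⟩
  · funext i
    have h1 := hsum i
    have h2 := hsum (i + 1)
    rw [partialSum_succ, partialSum_succ, partialSum_succ] at h2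
    rw [Pi.add_apply]
    omega
  · intro a b r h
    rw [hv, hv, one_mul, ← Nat.add_mul_div_left _ r (Nat.succ_pos k)]
    exact Nat.div_le_div_right (hu a b r h)
  · intro a b r h
    rw [hv', hv']
    refine (sub_div_mono k (hu a b r h)).trans ?_
    rw [Nat.add_mul_div_left _ r k.succ_pos, add_mul, Nat.succ_eq_add_one]
    omega
  · intro m d h
    rw [hv, h, Nat.mul_div_cancel_left d (Nat.succ_pos k)]

theorem partialSum_single (i m : ℕ) :
    partialSum (Pi.single i 1) m = if i < m then 1 else 0 := by
  simp [partialSum, Pi.single_apply]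

/-- The exchange property behind linear quotients: if `u` and `v` first differ at `i`, with
`v i < u i`, then a unit of `v` can be moved from a later position to `i`. -/
theorem IsIntervalBounded.exists_exchange {k i N : ℕ} {u v : ℕ → ℕ}
    (hu : IsIntervalBounded 𝒥 k u) (hv : IsIntervalBounded 𝒥 k v)
    (hlt : ∀ l < i, u l = v l) (hi : v i < u i) (hiN : i < N)
    (hN : partialSum u N = partialSum v N) :
    ∃ j, i < j ∧ j < N ∧ ∃ v' : ℕ → ℕ, v' + Pi.single j 1 = v + Pi.single i 1 ∧
      IsIntervalBounded 𝒥 k v' := by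
  have hex : ∃ j, i < j ∧ 0 < v j ∧ j < N := by
    by_contra! hcon
    have hc : ∀ m, i + 1 ≤ m → m ≤ N → partialSum v m = partialSum v (i + 1) := by
      intro m hm
      induction m, hm using Nat.le_induction with
      | base => exact fun _ => rfl
      | succ m hm ih =>
        intro hmN
        rw [partialSum_succ, ih (by omega)]
        have := hcon m (by omega)
        omega
    have h1 := hc N hiN le_rfl
    have h2 := partialSum_mono u (show i + 1 ≤ N from hiN)
    rw [partialSum_succ] at h1 h2
    have h3 := partialSum_congr hlt
    omega
  classical
  -- With `j` the first position after `i` where `v` is positive, moving a unit from `j` to `i`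
  -- raises the partial sums by one exactly on `(i, j]`, where those of `v` are constant.
  obtain ⟨hij, hvj, hjN⟩ := Nat.find_spec hex
  have hmin : ∀ l, i < l → l < Nat.find hex → v l = 0 := fun l hl hlj => by
    have := Nat.find_min hex hlj
    by_contra h0
    exact this ⟨hl, Nat.pos_of_ne_zero h0, hlj.trans hjN⟩
  generalize Nat.find hex = j at *
  have hle : Pi.single j 1 ≤ v + Pi.single i 1 := by
    intro l
    rcases eq_or_ne l j with rfl | h
    · simp only [Pi.single_eq_same, Pi.add_apply]; omega
    · simp [Pi.single_eq_of_ne h]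
  have heq : (v + Pi.single i 1 - Pi.single j 1) + Pi.single j 1 = v + Pi.single i 1 :=
    tsub_add_cancel_of_le hle
  refine ⟨j, hij, hjN, _, heq, ?_⟩
  generalize v + Pi.single i 1 - Pi.single j 1 = v' at heq
  have hps : ∀ m, partialSum v' m + (if j < m then 1 else 0)
      = partialSum v m + (if i < m then 1 else 0) := fun m => by
    rw [← partialSum_single, ← partialSum_single, ← partialSum_add, heq, partialSum_add]
  have hconst : ∀ m, i + 1 ≤ m → m ≤ j → partialSum v m = partialSum v (i + 1) := by
    intro m hm
    induction m, hm using Nat.le_induction with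
    | base => exact fun _ => rfl
    | succ m hm ih =>
      intro hmN
      rw [partialSum_succ, ih (by omega), hmin m (by omega) (by omega), add_zero]
  intro a b r h
  have ha := hps a
  have hb := hps b
  have h1 := hv a b r h
  rcases lt_or_ge i a with hia | hia
  · rw [if_pos hia] at ha
    by_cases hib : i < b
    · rw [if_pos hib] at hb
      by_cases hab : a ≤ b
      · split_ifs at ha hb <;> omega
      · have : partialSum v' b ≤ partialSum v' a := partialSum_mono v' (by omega)
        omega
    · have : partialSum v' b ≤ partialSum v' a := partialSum_mono v' (by omega)
      omega
  · rw [if_neg (by omega), if_neg (by omega)] at ha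
    by_cases hjb : j < b
    · rw [if_pos hjb, if_pos (by omega)] at hb
      omega
    · by_cases hib : i < b
      -- The only intervals that gain weight have `a ≤ i < b ≤ j`. There `v` weighs strictly less
      -- than `u`, since the two agree before `i`, `v i < u i`, and `v` vanishes on `(i, b)`; the
      -- bound for `u` leaves room for one unit.
      · rw [if_neg hjb, if_pos hib] at hb
        have h2 := hconst b hib (by omega)
        have h3 := hu a b r h
        have h4 := partialSum_mono u (show i + 1 ≤ b from hib)
        have h5 := partialSum_congr hlt
        have h6 := partialSum_congr (m := a) fun l hl => hlt l (by omega)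
        rw [partialSum_succ] at h2 h4
        omega
      · rw [if_neg hjb, if_neg hib] at hb
        omega

/-! ### Covers, duality and the combinatorics of persistence. -/

/-- `IntervalCover 𝒥 m Z r`: the interval `[0, m)` is covered by the points of `Z` and by (initial
parts of) intervals in `𝒥` of total capacity `r`. -/
inductive IntervalCover (𝒥 : Set (ℕ × ℕ × ℕ)) : ℕ → List ℕ → ℕ → Prop
  | nil : IntervalCover 𝒥 0 [] 0
  | point {m Z r} : IntervalCover 𝒥 m Z r → IntervalCover 𝒥 (m + 1) (m :: Z) r
  | interval {a b m Z r s} : IntervalCover 𝒥 a Z r → (a, b, s) ∈ 𝒥 → a ≤ m → m ≤ b →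
      IntervalCover 𝒥 m Z (r + s)

/-- Weak duality: each point of the cover contributes its own weight, each interval at most `k`
times its capacity. -/
theorem IntervalCover.partialSum_le {k m r : ℕ} {Z : List ℕ} (h : IntervalCover 𝒥 m Z r)
    {g : ℕ → ℕ} (hg : IsIntervalBounded 𝒥 k g) : partialSum g m ≤ (Z.map g).sum + k * r := by
  induction h with
  | nil => simp [partialSum]
  | point _ ih => rw [partialSum_succ, List.map_cons, List.sum_cons]; omega
  | interval _ hJ ham hmb ih =>
    have h1 := partialSum_mono g hmb
    have h2 := hg _ _ _ hJ
    rw [mul_add]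
    omega

/-- A cover may stop anywhere inside an interval, so truncation never costs more. This makes the
minimal cost monotone in `m`. -/
theorem IntervalCover.exists_of_le {m r : ℕ} {Z : List ℕ} (h : IntervalCover 𝒥 m Z r)
    (w : ℕ → ℕ) {l : ℕ} (hl : l ≤ m) :
    ∃ Z' r', IntervalCover 𝒥 l Z' r' ∧ (Z'.map w).sum ≤ (Z.map w).sum ∧ r' ≤ r := by
  induction h with
  | nil => exact ⟨[], 0, by rw [Nat.le_zero.mp hl]; exact .nil, le_rfl, le_rfl⟩
  | @point m Z r h ih =>
    rcases hl.eq_or_lt with rfl | hl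
    · exact ⟨_, _, .point h, le_rfl, le_rfl⟩
    · obtain ⟨Z', r', h1, h2, h3⟩ := ih (by omega)
      exact ⟨Z', r', h1, by rw [List.map_cons, List.sum_cons]; omega, h3⟩
  | @interval a b m Z r s h hJ ham hmb ih =>
    rcases le_total a l with hal | hal
    · exact ⟨Z, r + s, .interval h hJ hal (hl.trans hmb), le_rfl, le_rfl⟩
    · obtain ⟨Z', r', h1, h2, h3⟩ := ih hal
      exact ⟨Z', r', h1, h2, by omega⟩

theorem intervalCover_range (m : ℕ) : ∃ Z, IntervalCover 𝒥 m Z 0 := by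
  induction m with
  | zero => exact ⟨_, .nil⟩
  | succ m ih => exact ih.imp' (fun Z => m :: Z) fun _ h => .point h

/-- Max-min theorem for interval constraints: there is a `k`-bounded vector below `w` all of whose
partial sums are the cost of a cover. -/
theorem exists_isIntervalBounded_le (𝒥 : Set (ℕ × ℕ × ℕ)) (k : ℕ) (w : ℕ → ℕ) :
    ∃ u : ℕ → ℕ, u ≤ w ∧ IsIntervalBounded 𝒥 k u ∧
      ∀ m, ∃ Z r, IntervalCover 𝒥 m Z r ∧ partialSum u m = (Z.map w).sum + k * r := by
  let C : ℕ → Set ℕ := fun m => {x | ∃ Z r, IntervalCover 𝒥 m Z r ∧ x = (Z.map w).sum + k * r}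
  have hne : ∀ m, (C m).Nonempty := fun m =>
    (intervalCover_range m).elim fun Z hZ => ⟨(Z.map w).sum + k * 0, Z, 0, hZ, rfl⟩
  have hmono : Monotone fun m => sInf (C m) := by
    intro l m hlm
    obtain ⟨Z, r, h, hx⟩ := Nat.sInf_mem (hne m)
    obtain ⟨Z', r', h', h1, h2⟩ := h.exists_of_le w hlm
    show sInf (C l) ≤ sInf (C m)
    rw [hx]
    exact le_trans (Nat.sInf_le ⟨Z', r', h', rfl⟩)
      (add_le_add h1 (Nat.mul_le_mul_left k h2))
  -- The partial sums of `u` are the minimal cover costs. Extending an optimal cover by the point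
  -- `i` gives `u i ≤ w i`; extending it by an interval of `𝒥` gives the constraint for that
  -- interval.
  obtain ⟨u, hu⟩ := exists_partialSum_eq (U := fun m => sInf (C m))
    (Nat.le_zero.mp (Nat.sInf_le (show 0 ∈ C 0 from ⟨[], 0, .nil, by simp⟩))) hmono
  refine ⟨u, fun i => ?_, fun a b r hJ => ?_, fun m => ?_⟩
  · have h1 := partialSum_succ u i
    obtain ⟨Z, r, h, hx⟩ := Nat.sInf_mem (hne i)
    have h2 : sInf (C (i + 1)) ≤ ((i :: Z).map w).sum + k * r :=
      Nat.sInf_le ⟨i :: Z, r, .point h, rfl⟩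
    rw [List.map_cons, List.sum_cons] at h2
    rw [hu, hu] at h1
    show u i ≤ w i
    omega
  · rcases le_total a b with hab | hab
    · obtain ⟨Z, s, h, hx⟩ := Nat.sInf_mem (hne a)
      have h2 : sInf (C b) ≤ (Z.map w).sum + k * (s + r) :=
        Nat.sInf_le ⟨_, _, .interval h hJ hab le_rfl, rfl⟩
      rw [mul_add] at h2
      rw [hu, hu]
      omega
    · exact (partialSum_mono u hab).trans (Nat.le_add_right _ _)
  · rw [hu]
    exact Nat.sInf_mem (hne m)

/-- Capping the partial sums at `D` never increases a difference. -/
theorem IsIntervalBounded.exists_le_partialSum_eq {k N D : ℕ} {u : ℕ → ℕ}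
    (hu : IsIntervalBounded 𝒥 k u) (hD : D ≤ partialSum u N) :
    ∃ v ≤ u, IsIntervalBounded 𝒥 k v ∧ partialSum v N = D := by
  obtain ⟨v, hv⟩ := exists_partialSum_eq (U := fun m => min (partialSum u m) D)
    (by simp [partialSum]) fun _ _ h => min_le_min_right D (partialSum_mono u h)
  refine ⟨v, fun i => ?_, fun a b r h => ?_, by rw [hv]; omega⟩
  · have h1 := partialSum_succ u i
    have h2 := partialSum_succ v i
    rw [hv, hv] at h2
    show v i ≤ u i
    omega
  · have := hu a b r h
    rw [hv, hv]
    omega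

/-- The combinatorial form of strong persistence. -/
theorem exists_isIntervalBounded_le_of_add {k N d : ℕ} {w : ℕ → ℕ}
    (hne : ∃ g, IsIntervalBounded 𝒥 1 g ∧ partialSum g N = d)
    (hw : ∀ g, IsIntervalBounded 𝒥 1 g → partialSum g N = d →
      ∃ u, u ≤ w + g ∧ IsIntervalBounded 𝒥 (k + 1) u ∧ partialSum u N = (k + 1) * d) :
    ∃ u ≤ w, IsIntervalBounded 𝒥 k u ∧ partialSum u N = k * d := by
  obtain ⟨u, huw, hu, hcov⟩ := exists_isIntervalBounded_le 𝒥 k w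
  obtain ⟨Z, r, hZ, hr⟩ := hcov N
  suffices h : k * d ≤ partialSum u N by
    obtain ⟨v, hv, h1, h2⟩ := hu.exists_le_partialSum_eq h
    exact ⟨v, hv.trans huw, h1, h2⟩
  let G : Set ℕ := {x | ∃ g, IsIntervalBounded 𝒥 1 g ∧ partialSum g N = d ∧ x = (Z.map g).sum}
  have hG : G.Nonempty := hne.elim fun g h => ⟨_, g, h.1, h.2, rfl⟩
  obtain ⟨g, hg, hgd, hgm⟩ := Nat.sInf_mem hG
  have hmin : ∀ g', IsIntervalBounded 𝒥 1 g' → partialSum g' N = d →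
      (Z.map g).sum ≤ (Z.map g').sum := fun g' h1 h2 => by
    rw [← hgm]; exact Nat.sInf_le ⟨g', h1, h2, rfl⟩
  -- By integer decomposition, an `l`-bounded vector of degree `l * d` is a sum of `l` generators,
  -- each of weight on `Z` at least that of `g`.
  have hpow : ∀ l u, IsIntervalBounded 𝒥 l u → partialSum u N = l * d →
      l * (Z.map g).sum ≤ (Z.map u).sum := by
    intro l
    induction l with
    | zero => intro u _ _; simp
    | succ l ih =>
      intro u hu hud
      obtain ⟨v, v', rfl, hv, hv', hvd⟩ := hu.exists_add
      have h1 := hvd N d hud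
      rw [partialSum_add, h1, add_mul, one_mul] at hud
      have h2 := ih v' hv' (by omega)
      have h3 := hmin v hv h1
      have h4 : (Z.map (v + v')).sum = (Z.map v).sum + (Z.map v').sum := List.sum_map_add
      rw [h4, add_mul, one_mul]
      omega
  -- Write `g(Z)` for the weight of `g` on `Z`. Then `(k + 1) * g(Z) ≤ y(Z) ≤ w(Z) + g(Z)` gives `k
  -- * g(Z) ≤ w(Z)`, while weak duality gives `d ≤ g(Z) + r`. Hence `k * d ≤ w(Z) + k * r`.
  obtain ⟨y, hy, hyb, hyd⟩ := hw g hg hgd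
  have h1 := hpow _ y hyb hyd
  have h2 : (Z.map y).sum ≤ (Z.map (w + g)).sum := List.sum_le_sum fun i _ => hy i
  have h3 : (Z.map (w + g)).sum = (Z.map w).sum + (Z.map g).sum := List.sum_map_add
  have h4 := hZ.partialSum_le hg
  rw [hgd, one_mul] at h4
  have h5 := Nat.mul_le_mul_left k h4
  rw [add_mul, one_mul] at h1
  rw [mul_add] at h5
  omega

end IntervalConstraints

/-! ### Linear quotients and linear resolutions. -/

section LinearQuotients

open MvPolynomial

variable {K : Type*} [Field K] {n : ℕ}

/-- A family `v` of vectors of forms of degree `q`, indexed by a linear order, has linear quotients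
if the colon ideal of the span of the vectors before `v j` with respect to `v j` is generated by a
set `T j` of variables, for every `j`. -/
structure HasLinearQuotients {ι κ : Type*} [LinearOrder ι] (q : ℕ)
    (v : ι → κ → MvPolynomial (Fin n) K) (T : ι → Set (Fin n)) : Prop where
  isHomogeneous : ∀ j a, (v j a).IsHomogeneous q
  smul_mem_iff : ∀ j (s : MvPolynomial (Fin n) K),
    s • v j ∈ Submodule.span (MvPolynomial (Fin n) K) (v '' Set.Iio j) ↔
      s ∈ Ideal.span (X '' T j)

theorem homogeneousComponent_mul_of_isHomogeneous {q : ℕ} {p : MvPolynomial (Fin n) K}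
    (hp : p.IsHomogeneous q) (c : MvPolynomial (Fin n) K) (i : ℕ) :
    homogeneousComponent (i + q) (c * p) = homogeneousComponent i c * p := by
  let := gradedAlgebra (σ := Fin n) (R := K)
  have h := DirectSum.coe_decompose_mul_of_right_mem_of_le
    (homogeneousSubmodule (Fin n) K) (a := c) (n := i + q)
    ((mem_homogeneousSubmodule q p).mpr hp) (Nat.le_add_left q i)
  rw [Nat.add_sub_cancel] at h
  exact ((decomposition.decompose'_apply _ _).symm.trans h).trans
    (congrArg (· * p) (decomposition.decompose'_apply _ _))

/-- In any representation of `w`, the coefficients can be replaced by their degree-one components: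
comparing parts of degree `q + 1` keeps the sum. -/
theorem exists_isHomogeneous_one_of_mem_span {ι κ : Type*} [Fintype ι] {q : ℕ}
    {v : ι → κ → MvPolynomial (Fin n) K} (hv : ∀ j a, (v j a).IsHomogeneous q)
    {w : κ → MvPolynomial (Fin n) K} (hw : ∀ a, (w a).IsHomogeneous (q + 1)) {A : Set ι}
    (h : w ∈ Submodule.span (MvPolynomial (Fin n) K) (v '' A)) :
    ∃ c : ι → MvPolynomial (Fin n) K, (∀ l, (c l).IsHomogeneous 1) ∧ (∀ l ∉ A, c l = 0) ∧
      Fintype.linearCombination (MvPolynomial (Fin n) K) v c = w := by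
  obtain ⟨c, hcA, hc⟩ := (Finsupp.mem_span_image_iff_linearCombination _).mp h
  refine ⟨fun l => homogeneousComponent 1 (c l),
    fun l => homogeneousComponent_isHomogeneous 1 (c l), fun l hl => ?_, ?_⟩
  · have : c l = 0 := by
      by_contra h0
      exact hl (hcA (Finsupp.mem_support_iff.mpr h0))
    simp only [this, map_zero]
  · rw [Finsupp.linearCombination_apply, Finsupp.sum_fintype _ _ (by simp)] at hc
    funext a
    have h1 := congrArg (homogeneousComponent (1 + q)) (congrFun hc a)
    rw [homogeneousComponent_of_mem (p := w a) (add_comm q 1 ▸ hw a), if_pos rfl] at h1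
    simp only [Fintype.linearCombination_apply, Finset.sum_apply, Pi.smul_apply, smul_eq_mul,
      map_sum, homogeneousComponent_mul_of_isHomogeneous (hv _ a)] at h1 ⊢
    exact h1

variable {ι κ : Type*} [LinearOrder ι]

/-- The pairs `(j, i)` with `i ∈ T j`, ordered lexicographically. -/
abbrev QuotientIndex (T : ι → Set (Fin n)) : Type _ :=
  {p : Lex (ι × Fin n) // (ofLex p).2 ∈ T (ofLex p).1}

namespace HasLinearQuotients

variable {q : ℕ} {v : ι → κ → MvPolynomial (Fin n) K} {T : ι → Set (Fin n)}

theorem comp_orderIso {ι' : Type*} [LinearOrder ι'] (h : HasLinearQuotients q v T)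
    (φ : ι' ≃o ι) : HasLinearQuotients q (v ∘ φ) (T ∘ φ) where
  isHomogeneous j := h.isHomogeneous (φ j)
  smul_mem_iff j s := by
    rw [Set.image_comp, φ.image_Iio]
    exact h.smul_mem_iff (φ j) s

variable [Fintype ι]

/-- For `i ∈ T j`, rewriting `X i • v j` through earlier vectors yields a linear syzygy with leading
entry `X i` at `j`. -/
theorem exists_syzygy (h : HasLinearQuotients q v T) (p : QuotientIndex T) :
    ∃ e : ι → MvPolynomial (Fin n) K, (∀ l, (e l).IsHomogeneous 1) ∧
      e ∈ LinearMap.ker (Fintype.linearCombination (MvPolynomial (Fin n) K) v) ∧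
      e (ofLex p.1).1 = X (ofLex p.1).2 ∧ ∀ l, (ofLex p.1).1 < l → e l = 0 := by
  have hp := p.2
  generalize (ofLex p.1).1 = j at *
  generalize (ofLex p.1).2 = i at *
  obtain ⟨c, hc1, hc2, hc3⟩ := exists_isHomogeneous_one_of_mem_span h.isHomogeneous
    (w := (X i : MvPolynomial (Fin n) K) • v j)
    (fun a => by
      rw [add_comm]
      exact (isHomogeneous_X K i).mul (h.isHomogeneous j a))
    ((h.smul_mem_iff j _).mpr (Ideal.subset_span ⟨i, hp, rfl⟩))
  refine ⟨Pi.single j (X i) - c, fun l => ?_, ?_, ?_, fun l hl => ?_⟩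
  · refine IsHomogeneous.sub ?_ (hc1 l)
    rcases eq_or_ne l j with rfl | hl
    · rw [Pi.single_eq_same]; exact isHomogeneous_X K i
    · rw [Pi.single_eq_of_ne hl]; exact isHomogeneous_zero _ _ _
  · rw [LinearMap.mem_ker, map_sub, hc3, Fintype.linearCombination_apply_single, sub_self]
  · simp [hc2 j (lt_irrefl j)]
  · simp [Pi.single_eq_of_ne hl.ne', hc2 l (not_lt.mpr hl.le)]

variable {e : QuotientIndex T → ι → MvPolynomial (Fin n) K}

/-- Division with respect to the last nonzero position: the entry `z j` lies in the colon ideal,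
generated by the leading entries of the `e p` over `j`. Subtracting a combination of these clears
position `j`, and induction finishes. -/
theorem mem_span_syzygies_of_le (h : HasLinearQuotients q v T)
    (hker : ∀ p, e p ∈ LinearMap.ker (Fintype.linearCombination (MvPolynomial (Fin n) K) v))
    (hX : ∀ p, e p (ofLex p.1).1 = X (ofLex p.1).2)
    (hlt : ∀ p l, (ofLex p.1).1 < l → e p l = 0) (j : ι) :
    ∀ z ∈ LinearMap.ker (Fintype.linearCombination (MvPolynomial (Fin n) K) v),
      (∀ l, j < l → z l = 0) →
      z ∈ Submodule.span (MvPolynomial (Fin n) K) (e '' {p | (ofLex p.1).1 ≤ j}) := by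
  classical
  induction j using WellFoundedLT.induction with
  | ind j ih =>
    intro z hz hzj
    have h1 : z j ∈ Ideal.span (X '' T j) := by
      rw [← h.smul_mem_iff]
      have h0 : ∑ l, z l • v l = 0 := hz
      rw [← Finset.add_sum_erase _ _ (Finset.mem_univ j)] at h0
      rw [eq_neg_of_add_eq_zero_left h0]
      refine Submodule.neg_mem _ (Submodule.sum_mem _ fun l hl => ?_)
      rcases lt_or_gt_of_ne (Finset.ne_of_mem_erase hl) with hlj | hlj
      · exact Submodule.smul_mem _ _ (Submodule.subset_span ⟨l, hlj, rfl⟩)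
      · rw [hzj l hlj, zero_smul]; exact Submodule.zero_mem _
    have h2 : Ideal.span (X '' T j) =
        (Submodule.span (MvPolynomial (Fin n) K) (e '' {p | (ofLex p.1).1 = j})).map
          (LinearMap.proj j) := by
      rw [Submodule.map_span, ← Set.image_comp, Ideal.span]
      congr 1
      ext f
      constructor
      · rintro ⟨i, hi, rfl⟩
        exact ⟨⟨toLex (j, i), hi⟩, rfl, hX ⟨toLex (j, i), hi⟩⟩
      · rintro ⟨p, rfl, rfl⟩
        exact ⟨_, p.2, (hX p).symm⟩
    rw [h2] at h1
    obtain ⟨y, hy, hyj⟩ := h1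
    have hyker : y ∈ LinearMap.ker (Fintype.linearCombination (MvPolynomial (Fin n) K) v) :=
      (Submodule.span_le.mpr (by rintro _ ⟨p, -, rfl⟩; exact hker p)) hy
    have hylt : ∀ l, j < l → y l = 0 := fun l hl => by
      have : Submodule.span (MvPolynomial (Fin n) K) (e '' {p | (ofLex p.1).1 = j}) ≤
          LinearMap.ker (LinearMap.proj l) :=
        Submodule.span_le.mpr (by rintro _ ⟨p, rfl, rfl⟩; exact hlt p l hl)
      exact this hy
    have hyle : y ∈ Submodule.span (MvPolynomial (Fin n) K) (e '' {p | (ofLex p.1).1 ≤ j}) :=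
      Submodule.span_mono (Set.image_mono fun p hp => le_of_eq hp) hy
    rw [← sub_add_cancel z y]
    refine Submodule.add_mem _ ?_ hyle
    have hge : ∀ l, j ≤ l → (z - y) l = 0 := fun l hl => by
      rcases hl.eq_or_lt with rfl | hl
      · exact sub_eq_zero.mpr hyj.symm
      · rw [Pi.sub_apply, hzj l hl, hylt l hl, sub_zero]
    by_cases h0 : z - y = 0
    · rw [h0]; exact Submodule.zero_mem _
    · obtain ⟨l₀, hl₀⟩ := Function.ne_iff.mp h0
      obtain ⟨j', hj', hmax⟩ := (Set.toFinite {l | (z - y) l ≠ 0}).exists_le_maximal hl₀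
      have hjj : j' < j := lt_of_not_ge fun hle => hmax.1 (hge j' hle)
      refine Submodule.span_mono (Set.image_mono fun p hp => le_trans hp hjj.le)
        (ih j' hjj (z - y) (Submodule.sub_mem _ hz hyker) fun l hl => ?_)
      by_contra hne
      exact hl.not_ge (hmax.2 hne hl.le)

theorem mem_span_syzygies (h : HasLinearQuotients q v T)
    (hker : ∀ p, e p ∈ LinearMap.ker (Fintype.linearCombination (MvPolynomial (Fin n) K) v))
    (hX : ∀ p, e p (ofLex p.1).1 = X (ofLex p.1).2)
    (hlt : ∀ p l, (ofLex p.1).1 < l → e p l = 0) {A : Set ι} (hA : IsLowerSet A)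
    {z : ι → MvPolynomial (Fin n) K}
    (hz : z ∈ LinearMap.ker (Fintype.linearCombination (MvPolynomial (Fin n) K) v))
    (hzA : ∀ l ∉ A, z l = 0) :
    z ∈ Submodule.span (MvPolynomial (Fin n) K) (e '' {p | (ofLex p.1).1 ∈ A}) := by
  by_cases h0 : z = 0
  · rw [h0]; exact Submodule.zero_mem _
  · obtain ⟨l₀, hl₀⟩ := Function.ne_iff.mp h0
    obtain ⟨j, hj, hmax⟩ := (Set.toFinite {l | z l ≠ 0}).exists_le_maximal hl₀
    have hjA : j ∈ A := by
      by_contra hjA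
      exact hmax.1 (hzA j hjA)
    have hsub : {p : QuotientIndex T | (ofLex p.1).1 ≤ j} ⊆ {p | (ofLex p.1).1 ∈ A} :=
      fun p hp => hA hp hjA
    refine Submodule.span_mono (Set.image_mono hsub)
      (h.mem_span_syzygies_of_le hker hX hlt j z hz fun l hl => ?_)
    by_contra hne
    exact hl.not_ge (hmax.2 hne hl.le)

/-- The syzygy module of a family with linear quotients is generated by a family of vectors of
linear forms which again has linear quotients. -/
theorem exists_syzygies (h : HasLinearQuotients q v T) :
    ∃ (e : QuotientIndex T → ι → MvPolynomial (Fin n) K) (T' : QuotientIndex T → Set (Fin n)),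
      HasLinearQuotients 1 e T' ∧
      Submodule.span (MvPolynomial (Fin n) K) (Set.range e) =
        LinearMap.ker (Fintype.linearCombination (MvPolynomial (Fin n) K) v) := by
  choose e hhom hker hX hlt using h.exists_syzygy
  -- The colon variables of the syzygy `(j, i)` are the elements of `T j` smaller than `i`.
  refine ⟨e, fun p => {i | i ∈ T (ofLex p.1).1 ∧ i < (ofLex p.1).2}, ⟨hhom, fun p s => ?_⟩, ?_⟩
  · constructor
    · intro hs
      -- In coordinate `j`, syzygies over smaller positions vanish and the earlier ones over `j`
      -- have variables different from `X i` as entries. Since `X i` is a nonzerodivisor modulo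
      -- those variables, it can be cancelled.
      have h1 : s * X (ofLex p.1).2 ∈ Ideal.span
          (X '' {i | i ∈ T (ofLex p.1).1 ∧ i < (ofLex p.1).2}) := by
        have h2 := Submodule.mem_map_of_mem (f := LinearMap.proj (ofLex p.1).1) hs
        rw [Submodule.map_span, LinearMap.proj_apply, Pi.smul_apply, hX, smul_eq_mul] at h2
        refine (Submodule.span_le (p := Ideal.span _)).mpr ?_ h2
        rintro _ ⟨_, ⟨r, hr, rfl⟩, rfl⟩
        rcases Prod.Lex.lt_iff.mp (Subtype.coe_lt_coe.mpr hr) with hr1 | ⟨hr1, hr2⟩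
        · rw [LinearMap.proj_apply, hlt r _ hr1]
          exact Submodule.zero_mem _
        · rw [LinearMap.proj_apply, ← hr1, hX r]
          exact Ideal.subset_span ⟨_, ⟨r.2, hr2⟩, rfl⟩
      rw [mem_ideal_span_X_image] at h1 ⊢
      intro m hm
      obtain ⟨i, hi, hmi⟩ := h1 (m + Finsupp.single (ofLex p.1).2 1) (by
        rw [mem_support_iff, coeff_mul_X]
        exact mem_support_iff.mp hm)
      refine ⟨i, hi, ?_⟩
      rwa [Finsupp.add_apply, Finsupp.single_eq_of_ne hi.2.ne, add_zero] at hmi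
    · intro hs
      have hle : Ideal.span (X '' {i | i ∈ T (ofLex p.1).1 ∧ i < (ofLex p.1).2}) ≤
          (Submodule.span (MvPolynomial (Fin n) K) (e '' Set.Iio p)).comap
            (LinearMap.toSpanSingleton _ _ (e p)) := by
        refine Submodule.span_le.mpr ?_
        rintro _ ⟨i, ⟨hi, hilt⟩, rfl⟩
        let r : QuotientIndex T := ⟨toLex ((ofLex p.1).1, i), hi⟩
        have hrp : r < p := Prod.Lex.lt_iff.mpr (Or.inr ⟨rfl, hilt⟩)
        have hrX : e r (ofLex p.1).1 = X i := hX r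
        have hrlt : ∀ l, (ofLex p.1).1 < l → e r l = 0 := hlt r
        -- `X i • e p - X i' • e r`, where `p = (j, i')` and `r = (j, i)`, is a syzygy vanishing
        -- from position `j` on, hence generated by the syzygies over positions before `j`.
        have h1 := h.mem_span_syzygies hker hX hlt (isLowerSet_Iio (ofLex p.1).1)
          (Submodule.sub_mem _ (Submodule.smul_mem _ (X i) (hker p))
            (Submodule.smul_mem _ (X (ofLex p.1).2) (hker r))) fun l hl => by
            rw [Pi.sub_apply, Pi.smul_apply, Pi.smul_apply]
            rcases (not_lt.mp hl).eq_or_lt with rfl | hl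
            · rw [hX, hrX, smul_eq_mul, smul_eq_mul, mul_comm, sub_self]
            · rw [hlt p l hl, hrlt l hl, smul_zero, smul_zero, sub_zero]
        have h2 : Submodule.span (MvPolynomial (Fin n) K)
            (e '' {x | (ofLex x.1).1 ∈ Set.Iio (ofLex p.1).1}) ≤
            Submodule.span (MvPolynomial (Fin n) K) (e '' Set.Iio p) :=
          Submodule.span_mono (Set.image_mono fun x hx => Prod.Lex.lt_iff.mpr (Or.inl hx))
        have h3 : e r ∈ Submodule.span (MvPolynomial (Fin n) K) (e '' Set.Iio p) :=
          Submodule.subset_span ⟨r, hrp, rfl⟩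
        have h4 := Submodule.add_mem _ (h2 h1) (Submodule.smul_mem _ (X (ofLex p.1).2) h3)
        rwa [sub_add_cancel] at h4
      exact hle hs
  · refine le_antisymm (Submodule.span_le.mpr (by rintro _ ⟨p, rfl⟩; exact hker p)) fun z hz => ?_
    have := h.mem_span_syzygies hker hX hlt isLowerSet_univ hz fun l hl => (hl trivial).elim
    exact Submodule.span_mono (Set.image_subset_range _ _) this

theorem exists_fin_syzygies (h : HasLinearQuotients q v T) :
    ∃ (m : ℕ) (e : Fin m → ι → MvPolynomial (Fin n) K) (T' : Fin m → Set (Fin n)),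
      HasLinearQuotients 1 e T' ∧
      Submodule.span (MvPolynomial (Fin n) K) (Set.range e) =
        LinearMap.ker (Fintype.linearCombination (MvPolynomial (Fin n) K) v) := by
  classical
  obtain ⟨e, T', he, hspan⟩ := h.exists_syzygies
  have φ : Fin (Fintype.card (QuotientIndex T)) ≃o QuotientIndex T :=
    Fintype.orderIsoFinOfCardEq _ rfl
  exact ⟨_, e ∘ φ, T' ∘ φ, he.comp_orderIso φ, by rw [φ.surjective.range_comp, hspan]⟩

end HasLinearQuotients

variable (K n) in
/-- A finite family of vectors of linear forms with linear quotients. -/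
structure LinearQuotientFamily where
  rank : ℕ
  card : ℕ
  vec : Fin card → Fin rank → MvPolynomial (Fin n) K
  vars : Fin card → Set (Fin n)
  hasLinearQuotients : HasLinearQuotients 1 vec vars

namespace LinearQuotientFamily

/-- Generators of the syzygy module, with linear quotients. -/
noncomputable def syzygies (F : LinearQuotientFamily K n) : LinearQuotientFamily K n where
  rank := F.card
  card := F.hasLinearQuotients.exists_fin_syzygies.choose
  vec := F.hasLinearQuotients.exists_fin_syzygies.choose_spec.choose
  vars := F.hasLinearQuotients.exists_fin_syzygies.choose_spec.choose_spec.choose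
  hasLinearQuotients :=
    F.hasLinearQuotients.exists_fin_syzygies.choose_spec.choose_spec.choose_spec.1

theorem span_range_syzygies_vec (F : LinearQuotientFamily K n) :
    Submodule.span (MvPolynomial (Fin n) K) (Set.range F.syzygies.vec) =
      LinearMap.ker (Fintype.linearCombination (MvPolynomial (Fin n) K) F.vec) :=
  F.hasLinearQuotients.exists_fin_syzygies.choose_spec.choose_spec.choose_spec.2

/-- The iterated syzygies. -/
noncomputable def iterSyzygies (F : LinearQuotientFamily K n) : ℕ → LinearQuotientFamily K n
  | 0 => F
  | i + 1 => (F.iterSyzygies i).syzygies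

end LinearQuotientFamily

theorem mulVecLin_of_eq_linearCombination {m r : ℕ}
    (e : Fin m → Fin r → MvPolynomial (Fin n) K) :
    (Matrix.of fun a s => e s a).mulVecLin =
      Fintype.linearCombination (MvPolynomial (Fin n) K) e := by
  refine LinearMap.ext fun z => funext fun a => ?_
  simp [Matrix.mulVec, dotProduct, Fintype.linearCombination_apply, mul_comm]

/-- An ideal generated by forms of degree `q` with linear quotients has a `q`-linear resolution. -/
theorem HasLinearQuotients.hasLinearResolution {m q : ℕ} {g : Fin m → MvPolynomial (Fin n) K}
    {T : Fin m → Set (Fin n)} (h : HasLinearQuotients q (fun j (_ : Unit) => g j) T) :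
    HasLinearResolution q (Ideal.span (Set.range g)) := by
  obtain ⟨m', e, T', he, hspan⟩ := h.exists_fin_syzygies
  have hker : LinearMap.ker (Fintype.linearCombination (MvPolynomial (Fin n) K)
      fun j (_ : Unit) => g j) =
      LinearMap.ker (Fintype.linearCombination (MvPolynomial (Fin n) K) g) := by
    ext z
    rw [LinearMap.mem_ker, LinearMap.mem_ker, funext_iff]
    simp [Fintype.linearCombination_apply]
  -- `F` holds the first syzygies, whose entries are linear whatever `q` is. The rank of each later
  -- family is by definition the number of vectors of the preceding one, so consecutive matrices
  -- fit.
  let F : LinearQuotientFamily K n := ⟨m, m', e, T', he⟩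
  refine ⟨fun i => (F.iterSyzygies i).rank, g,
    fun i => Matrix.of fun a s => (F.iterSyzygies i).vec s a,
    fun j => h.isHomogeneous j (), fun i a s => (F.iterSyzygies i).hasLinearQuotients.isHomogeneous s a,
    Fintype.range_linearCombination _ _, ?_, fun i => ?_⟩
  · refine (congrArg LinearMap.range (mulVecLin_of_eq_linearCombination e)).trans ?_
    exact (Fintype.range_linearCombination _ _).trans (hspan.trans hker)
  · refine (congrArg LinearMap.range (mulVecLin_of_eq_linearCombination _)).trans ?_
    refine (Fintype.range_linearCombination _ _).trans ?_
    refine ((F.iterSyzygies i).span_range_syzygies_vec).trans ?_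
    exact congrArg LinearMap.ker (mulVecLin_of_eq_linearCombination _).symm

end LinearQuotients

/-! ### Monomial ideals defined by interval constraints. -/

section IntervalIdeals

open MvPolynomial

variable {n : ℕ}

/-- The extension by zero of an exponent vector to all natural numbers. -/
def extendZero (u : Fin n →₀ ℕ) (i : ℕ) : ℕ := if h : i < n then u ⟨i, h⟩ else 0

theorem extendZero_val (u : Fin n →₀ ℕ) (i : Fin n) : extendZero u i = u i := by
  simp [extendZero]

theorem extendZero_of_le (u : Fin n →₀ ℕ) {i : ℕ} (h : n ≤ i) : extendZero u i = 0 := by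
  simp [extendZero, not_lt.mpr h]

theorem extendZero_injective : Function.Injective (extendZero (n := n)) := fun u v h => by
  ext i
  rw [← extendZero_val, h, extendZero_val]

theorem extendZero_add (u v : Fin n →₀ ℕ) :
    extendZero (u + v) = extendZero u + extendZero v := by
  funext i
  by_cases h : i < n <;> simp [extendZero, h]

theorem extendZero_single (i : Fin n) :
    extendZero (Finsupp.single i 1) = Pi.single (i : ℕ) 1 := by
  funext l
  by_cases h : l < n
  · simp [extendZero, h, Finsupp.single_apply, Pi.single_apply, Fin.ext_iff, eq_comm]
  · have : l ≠ i := by have := i.2; omega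
    simp [extendZero, h, this]

theorem extendZero_le_iff {u v : Fin n →₀ ℕ} : extendZero u ≤ extendZero v ↔ u ≤ v := by
  constructor
  · intro h i
    rw [← extendZero_val, ← extendZero_val]
    exact h i
  · intro h i
    by_cases hi : i < n
    · simpa [extendZero, hi] using h ⟨i, hi⟩
    · simp [extendZero, hi]

theorem exists_extendZero_eq {v : ℕ → ℕ} (hv : ∀ i, n ≤ i → v i = 0) :
    ∃ u : Fin n →₀ ℕ, extendZero u = v := by
  refine ⟨Finsupp.equivFunOnFinite.symm fun i => v i, ?_⟩
  funext i
  by_cases h : i < n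
  · simp [extendZero, h]
  · simp [extendZero, h, hv i (not_lt.mp h)]

theorem exists_extendZero_eq_of_le {v : ℕ → ℕ} {w : Fin n →₀ ℕ} (hv : v ≤ extendZero w) :
    ∃ u : Fin n →₀ ℕ, extendZero u = v :=
  exists_extendZero_eq fun i hi =>
    Nat.le_zero.mp ((hv i).trans (extendZero_of_le w hi).le)

theorem partialSum_extendZero (u : Fin n →₀ ℕ) : partialSum (extendZero u) n = u.degree := by
  rw [partialSum, ← Fin.sum_univ_eq_sum_range, Finsupp.degree_eq_sum]
  exact Finset.sum_congr rfl fun i _ => extendZero_val u i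

/-- The exponent vectors of degree `k * d` with weight at most `k * r` on each interval `[a, b)`,
`(a, b, r) ∈ 𝒥`. -/
def intervalExponents (𝒥 : Set (ℕ × ℕ × ℕ)) (n d k : ℕ) : Set (Fin n →₀ ℕ) :=
  {u | IsIntervalBounded 𝒥 k (extendZero u) ∧ partialSum (extendZero u) n = k * d}

variable (K : Type*) [Field K] (𝒥 : Set (ℕ × ℕ × ℕ)) (d : ℕ)

/-- The monomial ideal generated by the monomials with exponents in `intervalExponents`. -/
noncomputable def intervalIdeal (n k : ℕ) : Ideal (MvPolynomial (Fin n) K) :=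
  Ideal.span ((fun u => monomial u (1 : K)) '' intervalExponents 𝒥 n d k)

theorem intervalExponents_finite (k : ℕ) : (intervalExponents 𝒥 n d k).Finite :=
  (Finsupp.finite_of_degree_le (k * d)).subset fun u hu => by
    rw [Set.mem_ofPred_eq, ← partialSum_extendZero, hu.2]

theorem zero_mem_intervalExponents : 0 ∈ intervalExponents 𝒥 n d 0 := by
  have h : extendZero (0 : Fin n →₀ ℕ) = 0 := by funext i; simp [extendZero]
  constructor
  · intro a b r _
    simp [h, partialSum]
  · simp [h, partialSum]

theorem mem_intervalExponents_succ {k : ℕ} {u : Fin n →₀ ℕ} :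
    u ∈ intervalExponents 𝒥 n d (k + 1) ↔
      ∃ v ∈ intervalExponents 𝒥 n d 1, ∃ v' ∈ intervalExponents 𝒥 n d k, v + v' = u := by
  constructor
  · rintro ⟨hu, hd⟩
    obtain ⟨w, w', hww, hw, hw', hwd⟩ := hu.exists_add
    obtain ⟨v, rfl⟩ := exists_extendZero_eq_of_le (w := u) (v := w)
      (by rw [hww]; exact le_self_add)
    obtain ⟨v', rfl⟩ := exists_extendZero_eq_of_le (w := u) (v := w')
      (by rw [hww]; exact le_add_self)
    have h1 := hwd n d hd
    refine ⟨v, ⟨hw, by rw [h1, one_mul]⟩, v', ⟨hw', ?_⟩, ?_⟩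
    · rw [hww, partialSum_add, h1, add_mul] at hd
      omega
    · exact extendZero_injective (by rw [extendZero_add, hww])
  · rintro ⟨v, ⟨hv, hvd⟩, v', ⟨hv', hvd'⟩, rfl⟩
    refine ⟨?_, ?_⟩
    · rw [extendZero_add, add_comm k]
      exact hv.add hv'
    · rw [extendZero_add, partialSum_add, hvd, hvd', add_mul, add_comm]

theorem intervalIdeal_one_pow (k : ℕ) : intervalIdeal K 𝒥 d n 1 ^ k = intervalIdeal K 𝒥 d n k := by
  induction k with
  | zero =>
    rw [pow_zero, Ideal.one_eq_top, eq_comm, Ideal.eq_top_iff_one]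
    exact Ideal.subset_span ⟨0, zero_mem_intervalExponents 𝒥 d, rfl⟩
  | succ k ih =>
    rw [pow_succ', ih, intervalIdeal, intervalIdeal, intervalIdeal, Ideal.span_mul_span']
    congr 1
    ext f
    constructor
    · rintro ⟨_, ⟨v, hv, rfl⟩, _, ⟨v', hv', rfl⟩, rfl⟩
      exact ⟨v + v', (mem_intervalExponents_succ 𝒥 d).mpr ⟨v, hv, v', hv', rfl⟩, by
        simp [monomial_mul]⟩
    · rintro ⟨u, hu, rfl⟩
      obtain ⟨v, hv, v', hv', rfl⟩ := (mem_intervalExponents_succ 𝒥 d).mp hu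
      exact ⟨_, ⟨v, hv, rfl⟩, _, ⟨v', hv', rfl⟩, by simp [monomial_mul]⟩

variable {K 𝒥 d}

/-- Membership in a monomial ideal is tested on the exponents in the support, and multiplication by
a monomial shifts the support. The colon condition thus becomes the hypothesis of
`exists_isIntervalBounded_le_of_add`. -/
theorem hasStrongPersistenceProperty_intervalIdeal (hne : intervalIdeal K 𝒥 d n 1 ≠ ⊥) :
    HasStrongPersistenceProperty (intervalIdeal K 𝒥 d n 1) := by
  obtain ⟨g₀, hg₀⟩ : (intervalExponents 𝒥 n d 1).Nonempty := by
    rw [Set.nonempty_iff_ne_empty]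
    rintro h
    exact hne (by rw [intervalIdeal, h, Set.image_empty, Ideal.span_empty])
  intro k
  refine le_antisymm (fun f hf => ?_) fun f hf => ?_
  · rw [intervalIdeal_one_pow, intervalIdeal, mem_ideal_span_monomial_image]
    intro w hw
    obtain ⟨u, huw, hu, hud⟩ := exists_isIntervalBounded_le_of_add (𝒥 := 𝒥) (k := k) (N := n)
      (d := d) (w := extendZero w) ⟨_, hg₀.1, by rw [hg₀.2, one_mul]⟩ fun g hg hgd => by
        -- `g` may be nonzero beyond `n`; cutting it off there replaces its partial sum at `m` by
        -- the one at `min m n`.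
        have hgN : IsIntervalBounded 𝒥 1 fun i => if i < n then g i else 0 := by
          have hps : ∀ m, partialSum (fun i => if i < n then g i else 0) m =
              partialSum g (min m n) := fun m => by
            rw [partialSum, partialSum, ← Finset.sum_filter]
            congr 1
            ext i
            simp
          intro a b r h
          have h1 := hg a b r h
          rw [hps, hps]
          rcases le_total a n with ha | ha
          · rw [min_eq_left ha]
            exact (partialSum_mono g (min_le_left b n)).trans h1
          · rw [min_eq_right ha]
            exact (partialSum_mono g (min_le_right b n)).trans (Nat.le_add_right _ _)
        obtain ⟨g', hg'⟩ := exists_extendZero_eq (n := n) (v := fun i => if i < n then g i else 0)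
          fun i hi => if_neg (not_lt.mpr hi)
        have hmem : g' ∈ intervalExponents 𝒥 n d 1 := by
          refine ⟨hg' ▸ hgN, ?_⟩
          rw [hg', one_mul, ← hgd]
          exact partialSum_congr fun i hi => if_pos hi
        have h1 := Submodule.mem_colon.mp hf (monomial g' (1 : K))
          (Ideal.subset_span ⟨g', hmem, rfl⟩)
        rw [intervalIdeal_one_pow, intervalIdeal, mem_ideal_span_monomial_image, smul_eq_mul] at h1
        obtain ⟨u, hu, hle⟩ := h1 (w + g') (by
          rw [mem_support_iff, coeff_mul_monomial, mul_one]
          exact mem_support_iff.mp hw)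
        refine ⟨extendZero u, fun i => ?_, hu.1, hu.2⟩
        refine (extendZero_le_iff.mpr hle i).trans ?_
        rw [extendZero_add, hg', Pi.add_apply, Pi.add_apply]
        refine Nat.add_le_add_left ?_ _
        show (if i < n then g i else 0) ≤ g i
        split_ifs
        · exact le_rfl
        · exact Nat.zero_le _
    obtain ⟨u', rfl⟩ := exists_extendZero_eq_of_le huw
    exact ⟨u', ⟨hu, hud⟩, extendZero_le_iff.mp huw⟩
  · refine Submodule.mem_colon.mpr fun g hg => ?_
    rw [pow_succ, smul_eq_mul]
    exact Ideal.mul_mem_mul hf hg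

/-- A criterion for linear quotients of a family of monomials. -/
theorem hasLinearQuotients_monomial {ι : Type*} [LinearOrder ι] {q : ℕ} {E : ι → Fin n →₀ ℕ}
    (hdeg : ∀ a, (E a).degree = q)
    (hE : ∀ a b, a < b → ∃ i, E b i < E a i ∧ ∃ c < b, E c ≤ E b + Finsupp.single i 1) :
    HasLinearQuotients q (fun a (_ : Unit) => monomial (E a) (1 : K))
      fun b => {i | ∃ c < b, E c ≤ E b + Finsupp.single i 1} where
  isHomogeneous a _ := isHomogeneous_monomial _ (hdeg a)
  smul_mem_iff b s := by
    constructor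
    · intro hs
      have h1 := Submodule.mem_map_of_mem (f := LinearMap.proj ()) hs
      rw [Submodule.map_span, ← Set.image_comp, LinearMap.proj_apply, Pi.smul_apply,
        smul_eq_mul] at h1
      have h2 : s * monomial (E b) 1 ∈
          Ideal.span ((fun u => monomial u (1 : K)) '' (E '' Set.Iio b)) := by
        rw [← Set.image_comp]
        exact h1
      rw [mem_ideal_span_monomial_image] at h2
      rw [mem_ideal_span_X_image]
      intro m hm
      obtain ⟨_, ⟨a, ha, rfl⟩, hle⟩ := h2 (m + E b) (by
        rw [mem_support_iff, coeff_mul_monomial, mul_one]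
        exact mem_support_iff.mp hm)
      -- Since `E a ≤ m + E b` and `E b i < E a i`, the variable `X i` divides the monomial of
      -- exponent `m`.
      obtain ⟨i, hi, hc⟩ := hE a b ha
      refine ⟨i, hc, ?_⟩
      have := hle i
      rw [Finsupp.add_apply] at this
      omega
    · intro hs
      have hle : Ideal.span (X '' {i | ∃ c < b, E c ≤ E b + Finsupp.single i 1}) ≤
          (Submodule.span (MvPolynomial (Fin n) K)
            ((fun a (_ : Unit) => monomial (E a) (1 : K)) '' Set.Iio b)).comap
            (LinearMap.toSpanSingleton _ _ fun _ => monomial (E b) (1 : K)) := by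
        refine Submodule.span_le.mpr ?_
        rintro _ ⟨i, ⟨c, hcb, hc⟩, rfl⟩
        have h1 : (X i : MvPolynomial (Fin n) K) • (fun _ : Unit => monomial (E b) (1 : K)) =
            monomial (E b + Finsupp.single i 1 - E c) (1 : K) •
              fun _ => monomial (E c) (1 : K) := by
          funext _
          rw [Pi.smul_apply, Pi.smul_apply, smul_eq_mul, smul_eq_mul, monomial_mul, X,
            monomial_mul, tsub_add_cancel_of_le hc, add_comm]
        rw [SetLike.mem_coe, Submodule.mem_comap, LinearMap.toSpanSingleton_apply, h1]
        exact Submodule.smul_mem _ _ (Submodule.subset_span ⟨c, hcb, rfl⟩)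
      exact hle hs

/-- The exchange raises `v` at `i` and lowers it only at a later position, so the new exponent is
lexicographically larger and precedes `v` in the decreasing order. -/
theorem exists_exchange_of_lex_lt {k : ℕ} {u v : Fin n →₀ ℕ} (hu : u ∈ intervalExponents 𝒥 n d k)
    (hv : v ∈ intervalExponents 𝒥 n d k) (huv : toLex v < toLex u) :
    ∃ i, v i < u i ∧ ∃ w ∈ intervalExponents 𝒥 n d k, toLex v < toLex w ∧
      w ≤ v + Finsupp.single i 1 := by
  obtain ⟨i, hlt, hi⟩ := Finsupp.Lex.lt_iff.mp huv
  have hi' : v i < u i := hi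
  obtain ⟨j, hij, hjn, w, hw, hwb⟩ := hu.1.exists_exchange (i := i) (N := n) hv.1
    (fun l hl => by
      have := hlt ⟨l, hl.trans i.2⟩ hl
      have h : v ⟨l, hl.trans i.2⟩ = u ⟨l, hl.trans i.2⟩ := this
      simp [extendZero, hl.trans i.2, h])
    (by rwa [extendZero_val, extendZero_val]) i.2 (by rw [hu.2, hv.2])
  rw [← extendZero_single i, ← extendZero_add] at hw
  obtain ⟨w, rfl⟩ := exists_extendZero_eq_of_le (v := w) (hw ▸ le_self_add)
  have hw' : w + Finsupp.single ⟨j, hjn⟩ 1 = v + Finsupp.single i 1 :=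
    extendZero_injective (by rw [extendZero_add, extendZero_single ⟨j, hjn⟩, hw])
  refine ⟨i, hi', w, ⟨hwb, ?_⟩, ?_, hw' ▸ le_self_add⟩
  · rw [partialSum_extendZero]
    have h1 := congrArg Finsupp.degree hw'
    rw [map_add, map_add, Finsupp.degree_single, Finsupp.degree_single] at h1
    have h2 := hv.2
    rw [partialSum_extendZero] at h2
    omega
  · refine Finsupp.Lex.lt_iff.mpr ⟨i, fun l hl => ?_, ?_⟩
    · have h1 := DFunLike.congr_fun hw' l
      rw [Finsupp.add_apply, Finsupp.add_apply, Finsupp.single_eq_of_ne (Fin.ne_of_lt hl),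
        Finsupp.single_eq_of_ne (Fin.ne_of_lt (hl.trans hij))] at h1
      exact h1.symm
    · have h1 := DFunLike.congr_fun hw' i
      rw [Finsupp.add_apply, Finsupp.add_apply, Finsupp.single_eq_same,
        Finsupp.single_eq_of_ne (Fin.ne_of_lt hij)] at h1
      show v i < w i
      omega

theorem hasLinearResolution_intervalIdeal (k : ℕ) :
    HasLinearResolution (k * d) (intervalIdeal K 𝒥 d n k) := by
  classical
  -- The order dual lists the generators in decreasing lexicographic order.
  let e : (Fin n →₀ ℕ) ≃ (Lex (Fin n →₀ ℕ))ᵒᵈ := toLex.trans OrderDual.toDual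
  let P : Finset (Lex (Fin n →₀ ℕ))ᵒᵈ :=
    (intervalExponents_finite 𝒥 d k).toFinset.map e.toEmbedding
  have hP : ∀ a ∈ P, e.symm a ∈ intervalExponents 𝒥 n d k := by
    intro a ha
    obtain ⟨u, hu, rfl⟩ := Finset.mem_map.mp ha
    simpa using hu
  have hP' : ∀ u ∈ intervalExponents 𝒥 n d k, e u ∈ P := fun u hu =>
    Finset.mem_map_of_mem _ ((Set.Finite.mem_toFinset _).mpr hu)
  have h := hasLinearQuotients_monomial (K := K) (q := k * d) (E := fun a : P => e.symm a.1)
    (fun a => by rw [← partialSum_extendZero]; exact (hP a.1 a.2).2)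
    (fun a b hab => by
      obtain ⟨i, hi, w, hw, hlt, hle⟩ := exists_exchange_of_lex_lt (hP a.1 a.2) (hP b.1 b.2) hab
      exact ⟨i, hi, ⟨e w, hP' w hw⟩, hlt, hle⟩)
  have h2 := (h.comp_orderIso (P.orderIsoOfFin rfl)).hasLinearResolution
    (g := fun j => monomial (e.symm (P.orderIsoOfFin rfl j).1) (1 : K))
  convert h2 using 1
  rw [intervalIdeal]
  congr 1
  ext f
  constructor
  · rintro ⟨u, hu, rfl⟩
    exact ⟨(P.orderIsoOfFin rfl).symm ⟨e u, hP' u hu⟩, by simp⟩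
  · rintro ⟨j, rfl⟩
    exact ⟨_, hP _ (P.orderIsoOfFin rfl j).2, rfl⟩

end IntervalIdeals

/-! ### Bounded spread multisets as interval constraints. -/

section BoundedSpread

variable {n : ℕ}

/-- The intervals `[a, a + t)` with capacity `1` and `[a, a + c * t + 1)` with capacity `c`. -/
def spreadIntervals (c t : ℕ) : Set (ℕ × ℕ × ℕ) :=
  {J | ∃ a, J = (a, a + t, 1) ∨ J = (a, a + c * t + 1, c)}

/-- In a sorted list the entries below `m` form an initial segment; this converts between positions
and counts. -/
theorem getElem_lt_iff_lt_countP {L : List (Fin n)} (hL : L.Pairwise (· ≤ ·)) (m : ℕ) {i : ℕ}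
    (hi : i < L.length) : (L[i] : ℕ) < m ↔ i < L.countP fun x : Fin n => (x : ℕ) < m := by
  induction L generalizing i with
  | nil => simp at hi
  | cons x l ih =>
    rw [List.pairwise_cons] at hL
    by_cases hx : (x : ℕ) < m
    · rw [List.countP_cons_of_pos (by simpa using hx)]
      cases i with
      | zero => simpa using hx
      | succ i =>
        rw [List.getElem_cons_succ, ih hL.2 (by simpa using hi)]
        omega
    · have hall : ∀ y ∈ x :: l, x ≤ y := by
        simpa using fun y hy => hL.1 y hy
      have h0 : (x :: l).countP (fun y : Fin n => (y : ℕ) < m) = 0 :=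
        List.countP_eq_zero.mpr fun y hy => by
          have : (x : ℕ) ≤ y := hall y hy
          simp only [decide_eq_true_eq]
          omega
      have h1 : (x : ℕ) ≤ ((x :: l)[i] : Fin n) := hall _ (List.getElem_mem hi)
      rw [h0]
      omega

theorem getElem_add_mul_le {t : ℕ} {L : List (Fin n)}
    (hL : L.IsChain fun i j : Fin n => (i : ℕ) + t ≤ (j : ℕ)) (s r : ℕ) (h : s + r < L.length) :
    (L[s] : ℕ) + r * t ≤ L[s + r] := by
  induction r with
  | zero => simp
  | succ r ih =>
    have h1 := ih (by omega)
    have h2 := hL.getElem (s + r) h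
    rw [add_mul, one_mul]
    simp only [← add_assoc] at *
    omega

theorem getElem_eq_add_mul {t : ℕ} {L : List (Fin n)}
    (hL : L.IsChain fun i j : Fin n => (i : ℕ) + t = (j : ℕ)) (r : ℕ) (h : r < L.length) :
    (L[r] : ℕ) = L[0] + r * t := by
  induction r with
  | zero => simp
  | succ r ih =>
    have h1 := ih (by omega)
    have h2 := hL.getElem r h
    rw [add_mul, one_mul]
    omega

/-- Two neighbours less than `t` apart share a window of length `t`. In a `t`-spread list, `c + 1`
consecutive entries span at least `c * t`, so they fit into a window of length `c * t + 1` exactly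
when all their gaps equal `t`. -/
theorem spread_bounded_iff_countP {c t : ℕ} {L : List (Fin n)} (hL : L.Pairwise (· ≤ ·)) :
    (L.IsChain (fun i j : Fin n => (i : ℕ) + t ≤ (j : ℕ)) ∧ ∀ B : List (Fin n), B <:+: L ∧
        B.IsChain (fun i j : Fin n => (i : ℕ) + t = (j : ℕ)) → B.length ≤ c) ↔
      ∀ a, (L.countP (fun x : Fin n => (x : ℕ) < a + t) ≤ L.countP (fun x : Fin n => (x : ℕ) < a) + 1) ∧
        L.countP (fun x : Fin n => (x : ℕ) < a + c * t + 1) ≤ L.countP (fun x : Fin n => (x : ℕ) < a) + c := by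
  constructor
  · rintro ⟨hch, hB⟩ a
    have hlen : ∀ m, L.countP (fun x : Fin n => (x : ℕ) < m) ≤ L.length := fun m => List.countP_le_length
    constructor
    · by_contra! hlt
      generalize hp : L.countP (fun x : Fin n => (x : ℕ) < a) = p at hlt
      have hl : p + 1 < L.length := by have := hlen (a + t); omega
      have h1 := (getElem_lt_iff_lt_countP hL (a + t) hl).mpr hlt
      have h2 := (getElem_lt_iff_lt_countP hL a (i := p) (by omega)).not.mpr (by omega)
      have h3 := hch.getElem p hl
      omega
    · by_contra! hlt
      generalize hp : L.countP (fun x : Fin n => (x : ℕ) < a) = p at hlt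
      have hl : p + c < L.length := by have := hlen (a + c * t + 1); omega
      have h1 := (getElem_lt_iff_lt_countP hL (a + c * t + 1) hl).mpr hlt
      have h2 := (getElem_lt_iff_lt_countP hL a (i := p) (by omega)).not.mpr (by omega)
      have hBlen : ((L.drop p).take (c + 1)).length = c + 1 := by
        rw [List.length_take, List.length_drop]
        omega
      have := hB ((L.drop p).take (c + 1)) ⟨(List.take_prefix _ _).isInfix.trans
        (List.drop_suffix _ _).isInfix, List.isChain_iff_getElem.mpr fun k hk => by
          rw [List.getElem_take, List.getElem_take, List.getElem_drop, List.getElem_drop]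
          rw [hBlen] at hk
          -- With `c = k + 1 + f`, the gaps before and after the chosen one take up at least `k * t`
          -- and `f * t` of a total of at most `c * t`, which forces this gap to be exactly `t`.
          obtain ⟨f, rfl⟩ := Nat.exists_eq_add_of_le (show k + 1 ≤ c by omega)
          have h3 := getElem_add_mul_le hch p k (by omega)
          have h4 := hch.getElem (p + k) (by omega)
          have h5 := getElem_add_mul_le hch (p + k + 1) f (by omega)
          have h6 : p + k + 1 + f = p + (k + 1 + f) := by omega
          simp only [h6] at h5
          simp only [add_mul, one_mul, ← add_assoc] at *
          omega⟩
      omega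
  · intro h
    constructor
    · refine List.isChain_iff_getElem.mpr fun i hi => ?_
      by_contra! hlt
      have h1 := (getElem_lt_iff_lt_countP hL _ hi).mp hlt
      have h2 := (getElem_lt_iff_lt_countP hL (L[i] : ℕ) (i := i) (by omega)).not.mp (lt_irrefl _)
      have h3 := (h (L[i] : ℕ)).1
      omega
    · rintro B ⟨⟨s, r, rfl⟩, hB⟩
      by_contra! hlt
      have hget : ∀ k (hk : k < B.length), (s ++ B ++ r)[s.length + k]'(by simp; omega) = B[k] :=
        fun k hk => by
          rw [List.getElem_append_left (by simp; omega), List.getElem_append_right (by omega)]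
          simp
      have h1 := getElem_eq_add_mul hB c hlt
      have h2 := (getElem_lt_iff_lt_countP hL (B[0] + c * t + 1) (i := s.length + c)
        (by simp; omega)).mp (by rw [hget c hlt]; omega)
      have h3 := (getElem_lt_iff_lt_countP hL (B[0] : ℕ) (i := s.length + 0)
        (by simp; omega)).not.mp (by rw [hget 0 (by omega)]; exact lt_irrefl _)
      have h4 := (h (B[0] : ℕ)).2
      omega

theorem partialSum_extendZero_toFinsupp (A : Multiset (Fin n)) (m : ℕ) :
    partialSum (extendZero (Multiset.toFinsupp A)) m = A.countP fun x : Fin n => (x : ℕ) < m := by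
  induction A using Multiset.induction with
  | empty => simp [partialSum, extendZero]
  | cons x A ih =>
    rw [← Multiset.singleton_add, map_add, extendZero_add, partialSum_add, ih,
      Multiset.toFinsupp_singleton, extendZero_single, partialSum_single, Multiset.countP_add]
    congr 1
    by_cases hx : (x : ℕ) < m <;> simp [Multiset.countP_eq_card_filter, Multiset.filter_singleton, hx]

theorem mem_boundedSpreadMultisets_iff {c d t : ℕ} {A : Multiset (Fin n)} :
    A ∈ boundedSpreadMultisets c n d t ↔
      Multiset.toFinsupp A ∈ intervalExponents (spreadIntervals c t) n d 1 := by
  have hcount : ∀ m, partialSum (extendZero (Multiset.toFinsupp A)) m =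
      (A.sort (· ≤ ·)).countP fun x : Fin n => (x : ℕ) < m := fun m => by
    rw [partialSum_extendZero_toFinsupp, ← Multiset.coe_countP, Multiset.sort_eq]
  have hcard : partialSum (extendZero (Multiset.toFinsupp A)) n = A.card := by
    rw [partialSum_extendZero_toFinsupp]
    exact Multiset.countP_eq_card.mpr fun x _ => x.2
  have h := spread_bounded_iff_countP (c := c) (t := t) (A.pairwise_sort (· ≤ ·))
  have h' : IsIntervalBounded (spreadIntervals c t) 1 (extendZero (Multiset.toFinsupp A)) ↔
      IsTSpread t A ∧ ∀ B : List (Fin n), IsTBlock t A B → B.length ≤ c := by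
    refine Iff.trans ?_ h.symm
    constructor
    · intro hb a
      have h1 := hb a (a + t) 1 ⟨a, Or.inl rfl⟩
      have h2 := hb a (a + c * t + 1) c ⟨a, Or.inr rfl⟩
      rw [hcount, hcount, one_mul] at h1 h2
      exact ⟨h1, h2⟩
    · rintro hb _ _ _ ⟨a, h1 | h1⟩
      · obtain ⟨rfl, rfl, rfl⟩ := by simpa only [Prod.mk.injEq] using h1
        rw [hcount, hcount, one_mul]
        exact (hb _).1
      · obtain ⟨rfl, rfl, rfl⟩ := by simpa only [Prod.mk.injEq] using h1
        rw [hcount, hcount, one_mul]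
        exact (hb _).2
  change A.card = d ∧ _ ↔ _ ∧ _
  rw [h', hcard, one_mul, and_comm]

theorem multisetMonomial_eq_monomial (K : Type*) [Field K] (A : Multiset (Fin n)) :
    multisetMonomial K A = MvPolynomial.monomial (Multiset.toFinsupp A) 1 := by
  induction A using Multiset.induction with
  | empty => simp [multisetMonomial]
  | cons x A ih =>
    rw [multisetMonomial] at ih ⊢
    rw [Multiset.map_cons, Multiset.prod_cons, ih, ← Multiset.singleton_add, map_add,
      Multiset.toFinsupp_singleton, MvPolynomial.X, MvPolynomial.monomial_mul, one_mul]

theorem boundedSpreadVeroneseIdeal_eq_intervalIdeal (K : Type*) [Field K] (c n d t : ℕ) :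
    boundedSpreadVeroneseIdeal K c n d t = intervalIdeal K (spreadIntervals c t) d n 1 := by
  rw [boundedSpreadVeroneseIdeal, intervalIdeal]
  congr 1
  ext f
  constructor
  · rintro ⟨A, hA, rfl⟩
    exact ⟨_, mem_boundedSpreadMultisets_iff.mp hA, (multisetMonomial_eq_monomial K A).symm⟩
  · rintro ⟨u, hu, rfl⟩
    have h : Multiset.toFinsupp (Finsupp.toMultiset u) = u := Finsupp.toMultiset_toFinsupp u
    exact ⟨Finsupp.toMultiset u, mem_boundedSpreadMultisets_iff.mpr (h.symm ▸ hu), by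
      rw [multisetMonomial_eq_monomial, h]⟩

end BoundedSpread

theorem mainTheorem5 {K : Type*} [Field K] (c n d t : ℕ) (hc : 0 < c) :
    (boundedSpreadVeroneseIdeal K c n d t ≠ ⊥ →
      HasStrongPersistenceProperty (boundedSpreadVeroneseIdeal K c n d t)) ∧
    ∀ k : ℕ, HasLinearResolution (k * d) (boundedSpreadVeroneseIdeal K c n d t ^ k) := by
  rw [boundedSpreadVeroneseIdeal_eq_intervalIdeal]
  refine ⟨hasStrongPersistenceProperty_intervalIdeal, fun k => ?_⟩
  rw [intervalIdeal_one_pow]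
  exact hasLinearResolution_intervalIdeal k
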